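/- For positive integers $n_1, n_2$, let $K_{n_1}\square K_{n_2}$ be the rook's graph, i.e. the Cartesian product of the complete graphs $K_{n_1}$ and $K_{n_2}$ on $n_1$ and $n_2$ vertices: its vertices are the pairs $(u,u')\in V(K_{n_1})\times V(K_{n_2})$, and $(u,u')$, $(v,v')$ are adjacent if and only if either $u=v$ and $u'$ is adjacent to $v'$ in $K_{n_2}$, or $u'=v'$ and $u$ is adjacent to $v$ in $K_{n_1}$. Let $\tau(G)$ denote the number of spanning trees of a finite simple graph $G$. Then $$\tau(K_{n_1}\square K_{n_2}) = n_1^{\,n_1-2}\, n_2^{\,n_2-2}\, (n_1+n_2)^{(n_1-1)(n_2-1)}.$$ -/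

import Mathlib

/-- The number `τ(G)` of spanning trees of a graph `G` on a (finite) vertex set `V`: the number of
graphs `T` on the whole vertex set `V` that are trees and all of whose edges are edges of `G`. -/
noncomputable def numSpanningTrees {V : Type*} (G : SimpleGraph V) : ℕ :=
  Nat.card {T : SimpleGraph V // T ≤ G ∧ T.IsTree}

/-! Put s = n₁ + n₂, let L be the Laplacian and J the all-ones matrix. The rook's graph is (s -
2)-regular, which makes s(L + s⁻¹J) = (sI - J) ⊗ (sI - J). Each factor of size n has determinant
s^(n-1)(s - n), while Temperley's identity det(L + cJ) = c|V|²τ evaluates the left side; comparing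
the two gives τ. Temperley's identity follows from the matrix tree theorem, itself obtained by
expanding the determinant over choices of a neighbour for each non-root vertex: only choices that
all lead to the root contribute, each with 1. -/

/-! ### Rooted parent functions and trees -/

/-- `f` is a parent function rooted at `r`: iterating `f` from any vertex ends in its
fixed point `r`. -/
def IsRootedAt {V : Type*} (r : V) (f : V → V) : Prop :=
  f r = r ∧ ∀ v, ∃ k, f^[k] v = r

/-- The graph joining every vertex `v` to `f v`. -/
def functionGraph {V : Type*} (f : V → V) : SimpleGraph V :=
  SimpleGraph.fromRel fun v w => f v = w

theorem functionGraph_adj {V : Type*} {f : V → V} {v w : V} :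
    (functionGraph f).Adj v w ↔ v ≠ w ∧ (f v = w ∨ f w = v) :=
  SimpleGraph.fromRel_adj _ _ _

namespace IsRootedAt

variable {V : Type*} {r : V} {f g : V → V}

theorem exists_height (hf : IsRootedAt r f) :
    ∃ h : V → ℕ, ∀ v, v ≠ r → h v = h (f v) + 1 := by
  classical
  refine ⟨fun v => Nat.find (hf.2 v), fun v hv => ?_⟩
  refine (Nat.find_eq_iff _).2 ⟨?_, fun n hn h => ?_⟩
  · rw [Function.iterate_succ_apply]
    exact Nat.find_spec (hf.2 (f v))
  · cases n with
    | zero => exact hv h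
    | succ n =>
      rw [Function.iterate_succ_apply] at h
      exact Nat.find_min (hf.2 (f v)) (Nat.succ_lt_succ_iff.1 hn) h

theorem of_height (hr : f r = r) (h : V → ℕ) (hh : ∀ v, v ≠ r → h (f v) < h v) :
    IsRootedAt r f := by
  refine ⟨hr, fun v => ?_⟩
  induction hn : h v using Nat.strong_induction_on generalizing v with
  | _ n ih =>
    by_cases hv : v = r
    · exact ⟨0, hv⟩
    · obtain ⟨k, hk⟩ := ih _ (hn ▸ hh v hv) (f v) rfl
      exact ⟨k + 1, hk⟩

theorem apply_ne (hf : IsRootedAt r f) {v : V} (hv : v ≠ r) : f v ≠ v := by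
  obtain ⟨h, hh⟩ := hf.exists_height
  intro e
  have := hh v hv
  rw [e] at this
  omega

theorem apply_apply_ne (hf : IsRootedAt r f) {v : V} (hv : v ≠ r) : f (f v) ≠ v := by
  obtain ⟨h, hh⟩ := hf.exists_height
  intro e
  have h1 := hh v hv
  by_cases hr : f v = r
  · rw [hr, hf.1] at e
    exact hv e.symm
  · have h2 := hh (f v) hr
    rw [e] at h2
    omega

theorem adj_apply (hf : IsRootedAt r f) {v : V} (hv : v ≠ r) :
    (functionGraph f).Adj v (f v) :=
  functionGraph_adj.2 ⟨(hf.apply_ne hv).symm, .inl rfl⟩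

theorem connected (hf : IsRootedAt r f) : (functionGraph f).Connected := by
  have key : ∀ k v, f^[k] v = r → (functionGraph f).Reachable v r := by
    intro k
    induction k with
    | zero => rintro v rfl; rfl
    | succ k ih =>
      intro v hv
      by_cases hvr : v = r
      · rw [hvr]
      · exact (hf.adj_apply hvr).reachable.trans (ih (f v) hv)
  have hreach : ∀ v, (functionGraph f).Reachable v r := fun v =>
    (hf.2 v).elim fun k hk => key k v hk
  exact (SimpleGraph.connected_iff _).2 ⟨fun u v => (hreach u).trans (hreach v).symm, ⟨r⟩⟩

theorem isTree [Finite V] (hf : IsRootedAt r f) : (functionGraph f).IsTree := by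
  classical
  have := Fintype.ofFinite V
  refine SimpleGraph.isTree_iff_connected_and_card.2 ⟨hf.connected, le_antisymm ?_
    hf.connected.card_vert_le_card_edgeSet_add_one⟩
  have hsub : (functionGraph f).edgeSet ⊆ (fun v => s(v, f v)) '' ({r}ᶜ : Set V) := by
    intro e
    induction e with
    | _ v w =>
      rw [SimpleGraph.mem_edgeSet, functionGraph_adj]
      rintro ⟨hne, rfl | rfl⟩
      · exact ⟨v, fun h => hne (by rw [h, hf.1]), rfl⟩
      · exact ⟨w, fun h => hne (by rw [h, hf.1]), Sym2.eq_swap⟩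
  have h1 := (Set.ncard_le_ncard hsub (Set.toFinite _)).trans
    (Set.ncard_image_le (Set.toFinite _))
  have h2 := Set.ncard_add_ncard_compl ({r} : Set V)
  rw [Set.ncard_singleton] at h2
  rw [Nat.card_coe_set_eq]
  omega

theorem eq_of_functionGraph_eq [Finite V] (hf : IsRootedAt r f) (hg : IsRootedAt r g)
    (h : functionGraph f = functionGraph g) : f = g := by
  obtain ⟨ht, hht⟩ := hf.exists_height
  by_contra hne
  obtain ⟨v₀, hv₀⟩ := Function.ne_iff.1 hne
  -- At a highest disagreement `v`, the edge to `g v` must come from `f (g v) = v`, so `g v` is a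
  -- higher disagreement.
  obtain ⟨v, hv, hmax⟩ := Set.exists_max_image {v | f v ≠ g v} ht (Set.toFinite _) ⟨v₀, hv₀⟩
  have hvr : v ≠ r := by
    rintro rfl
    exact hv (hf.1.trans hg.1.symm)
  have hadj := hg.adj_apply hvr
  rw [← h, functionGraph_adj] at hadj
  have hfg : f (g v) = v := hadj.2.resolve_left hv
  have hgr : g v ≠ r := by
    intro e
    rw [e, hf.1] at hfg
    exact hvr hfg.symm
  have hlt := hht (g v) hgr
  have hle := hmax (g v) (by
    rw [Set.mem_ofPred_eq, hfg]
    exact (hg.apply_apply_ne hvr).symm)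
  rw [hfg] at hlt
  omega

end IsRootedAt

theorem SimpleGraph.Connected.exists_adj_dist_lt {V : Type*} {G : SimpleGraph V}
    (hG : G.Connected) {r v : V} (hv : v ≠ r) : ∃ w, G.Adj v w ∧ G.dist w r < G.dist v r := by
  obtain ⟨p, hp⟩ := hG.exists_walk_length_eq_dist v r
  cases p with
  | nil => exact absurd rfl hv
  | @cons _ w _ hadj q =>
    refine ⟨w, hadj, ?_⟩
    have := SimpleGraph.dist_le q
    rw [SimpleGraph.Walk.length_cons] at hp
    omega

theorem SimpleGraph.IsTree.exists_isRootedAt {V : Type*} {T : SimpleGraph V} (hT : T.IsTree)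
    (r : V) : ∃ f, IsRootedAt r f ∧ functionGraph f = T := by
  classical
  choose! p hp using fun v (hv : v ≠ r) => hT.connected.exists_adj_dist_lt hv
  have hf : IsRootedAt r fun v => if v = r then r else p v :=
    .of_height (by simp) (fun v => T.dist v r) fun v hv => by simpa [hv] using (hp v hv).2
  refine ⟨_, hf, ?_⟩
  have hle : functionGraph (fun v => if v = r then r else p v) ≤ T := by
    have key : ∀ v w, v ≠ w → (if v = r then r else p v) = w → T.Adj v w := by
      intro v w hne h
      by_cases hv : v = r
      · rw [if_pos hv] at h
        exact absurd (hv.trans h) hne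
      · rw [if_neg hv] at h
        exact h ▸ (hp v hv).1
    intro v w h
    obtain ⟨hne, h | h⟩ := functionGraph_adj.1 h
    · exact key v w hne h
    · exact (key w v hne.symm h).symm
  exact (SimpleGraph.isTree_iff_minimal_connected.1 hT).eq_of_le hf.connected hle

/-- Spanning trees correspond to the parent functions towards a fixed root along edges. -/
theorem numSpanningTrees_eq_card_isRootedAt {V : Type*} [Finite V] (G : SimpleGraph V) (r : V) :
    numSpanningTrees G =
      Nat.card {f : V → V // IsRootedAt r f ∧ ∀ v, v ≠ r → G.Adj v (f v)} := by
  symm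
  refine Nat.card_congr (Equiv.ofBijective
    (fun f => ⟨functionGraph f.1, fun v w h => ?_, f.2.1.isTree⟩) ⟨fun f g h => ?_, fun T => ?_⟩)
  · have key : ∀ v w, v ≠ w → f.1 v = w → G.Adj v w := by
      intro v w hne e
      have hv : v ≠ r := by
        rintro rfl
        exact hne (f.2.1.1.symm.trans e)
      exact e ▸ f.2.2 v hv
    obtain ⟨hne, h | h⟩ := functionGraph_adj.1 h
    · exact key v w hne h
    · exact (key w v hne.symm h).symm
  · exact Subtype.ext (f.2.1.eq_of_functionGraph_eq g.2.1 (congrArg Subtype.val h))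
  · obtain ⟨f, hf, hfT⟩ := T.2.2.exists_isRootedAt r
    exact ⟨⟨f, hf, fun v hv => T.2.1 (hfT ▸ hf.adj_apply hv)⟩, Subtype.ext hfT⟩

/-! ### The matrix tree theorem -/

-- Ordering the vertices by height makes the matrix triangular with unit diagonal.
open Matrix in
theorem IsRootedAt.det_eq_one {V R : Type*} [Fintype V] [DecidableEq V] [CommRing R] {r : V}
    {f : V → V} (hf : IsRootedAt r f) :
    (Matrix.of fun v : V => if v = r then Pi.single r (1 : R)
      else Pi.single v 1 - Pi.single (f v) 1).det = 1 := by
  obtain ⟨h, hh⟩ := hf.exists_height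
  set M := Matrix.of fun v : V => if v = r then Pi.single r (1 : R)
      else Pi.single v 1 - Pi.single (f v) 1 with hM
  have hzero : ∀ v w, v ≠ w → h v ≤ h w → M v w = 0 := by
    intro v w hne hle
    by_cases hv : v = r
    · subst hv
      simp [hM, hne.symm]
    · have hw : w ≠ f v := by
        rintro rfl
        have := hh v hv
        omega
      simp [hM, hv, hne.symm, hw]
  have hdiag : ∀ v, M v v = 1 := by
    intro v
    by_cases hv : v = r
    · subst hv
      simp [hM]
    · simp [hM, hv, (hf.apply_ne hv).symm]
  have hT : BlockTriangular M fun v => OrderDual.toDual (h v) := fun v w hlt =>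
    hzero v w (by rintro rfl; exact lt_irrefl _ hlt) (le_of_lt hlt)
  rw [hT.det]
  refine Finset.prod_eq_one fun k _ => ?_
  have : M.toSquareBlock (fun v => OrderDual.toDual (h v)) k = 1 := by
    ext ⟨v, hv⟩ ⟨w, hw⟩
    rw [toSquareBlock_def, of_apply, one_apply]
    split_ifs with e
    · rw [Subtype.mk.injEq] at e
      subst e
      exact hdiag v
    · exact hzero v w (fun e' => e (Subtype.ext e'))
        (le_of_eq (OrderDual.toDual.injective (hv.trans hw.symm)))
  rw [this, det_one]

-- The indicator of the vertices that never reach `r` is a nonzero kernel vector.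
open Matrix in
theorem det_eq_zero_of_not_isRootedAt {V R : Type*} [Fintype V] [DecidableEq V] [CommRing R]
    [IsDomain R] {r : V} {f : V → V} (hr : f r = r) (hf : ¬ IsRootedAt r f) :
    (Matrix.of fun v : V => if v = r then Pi.single r (1 : R)
      else Pi.single v 1 - Pi.single (f v) 1).det = 0 := by
  classical
  obtain ⟨v₀, hv₀⟩ : ∃ v, ∀ k, f^[k] v ≠ r := by
    by_contra! h
    exact hf ⟨hr, h⟩
  rw [← exists_mulVec_eq_zero_iff]
  refine ⟨fun v => if ∃ k, f^[k] v = r then 0 else 1, fun h => ?_, ?_⟩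
  · have := congrFun h v₀
    simp [hv₀] at this
  · have hroot : ∃ k, f^[k] r = r := ⟨0, rfl⟩
    ext v
    by_cases hv : v = r
    · simp [mulVec, hv, hroot]
    · have hiff : (∃ k, f^[k] v = r) ↔ ∃ k, f^[k] (f v) = r := by
        constructor
        · rintro ⟨_ | k, hk⟩
          · exact absurd hk hv
          · exact ⟨k, hk⟩
        · rintro ⟨k, hk⟩
          exact ⟨k + 1, hk⟩
      change (if v = r then Pi.single r (1 : R) else Pi.single v 1 - Pi.single (f v) 1) ⬝ᵥ _ = 0
      rw [if_neg hv, sub_dotProduct, single_one_dotProduct, single_one_dotProduct]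
      simp only [hiff, sub_self]

/-- **Kirchhoff's matrix tree theorem**: replacing the row of the Laplacian at `r` by a
standard basis vector gives a matrix whose determinant counts spanning trees. -/
theorem det_lapMatrix_updateRow_single {V R : Type*} [Fintype V] [DecidableEq V] [CommRing R]
    [IsDomain R] (G : SimpleGraph V) [DecidableRel G.Adj] (r : V) :
    ((G.lapMatrix R).updateRow r (Pi.single r 1)).det = numSpanningTrees G := by
  classical
  let A : V → Finset V := fun v => if v = r then {r} else G.neighborFinset v
  let row : V → V → V → R := fun v w =>
    if v = r then Pi.single r 1 else Pi.single v 1 - Pi.single w 1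
  have hrow : (G.lapMatrix R).updateRow r (Pi.single r 1) =
      Matrix.of fun v => ∑ w ∈ A v, row v w := by
    ext v u
    by_cases hv : v = r
    · subst hv
      simp [A, row]
    · rw [Matrix.updateRow_ne hv, Matrix.of_apply, Finset.sum_apply]
      simp only [A, row, if_neg hv, Pi.sub_apply, Finset.sum_sub_distrib, Finset.sum_const,
        SimpleGraph.card_neighborFinset_eq_degree, nsmul_eq_mul, Pi.single_apply,
        eq_comm (a := u), Finset.sum_ite_eq', SimpleGraph.mem_neighborFinset, SimpleGraph.lapMatrix,
        SimpleGraph.degMatrix, Matrix.sub_apply, Matrix.diagonal_apply,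
        SimpleGraph.adjMatrix_apply, mul_ite, mul_one, mul_zero]
  -- Multilinearity of the determinant in its rows.
  have hexp : (Matrix.of fun v => ∑ w ∈ A v, row v w).det =
      ∑ f ∈ Fintype.piFinset A, (Matrix.of fun v => row v (f v)).det :=
    (Matrix.detRowAlternating (n := V) (R := R)).toMultilinearMap.map_sum_finset row A
  have hA : ∀ f, f ∈ Fintype.piFinset A ↔ f r = r ∧ ∀ v, v ≠ r → G.Adj v (f v) := by
    intro f
    rw [Fintype.mem_piFinset]
    constructor
    · refine fun h => ⟨by simpa [A] using h r, fun v hv => by simpa [A, hv] using h v⟩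
    · rintro ⟨h1, h2⟩ v
      by_cases hv : v = r
      · simp [A, hv, h1]
      · simpa [A, hv] using h2 v hv
  have hdet : ∀ f ∈ Fintype.piFinset A, (Matrix.of fun v => row v (f v)).det =
      if IsRootedAt r f then 1 else 0 := by
    intro f hf
    split_ifs with h
    · exact h.det_eq_one
    · exact det_eq_zero_of_not_isRootedAt ((hA f).1 hf).1 h
  rw [hrow, hexp, Finset.sum_congr rfl hdet, Finset.sum_boole,
    numSpanningTrees_eq_card_isRootedAt G r, Nat.card_eq_fintype_card, Fintype.card_subtype]
  congr 2
  ext f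
  simp only [Finset.mem_filter, Finset.mem_univ, true_and, hA]
  exact ⟨fun h => ⟨h.2, h.1.2⟩, fun h => ⟨⟨h.1.1, h.2⟩, h.1⟩⟩

open Matrix in
/-- In a matrix with zero row sums, the determinant after replacing a row depends only on the
sum of the entries of the new row. -/
theorem det_updateRow_of_mulVec_one_eq_zero {V R : Type*} [Fintype V] [DecidableEq V] [CommRing R]
    [IsDomain R] {L : Matrix V V R} (hL : L *ᵥ 1 = 0) (r : V) (x : V → R) :
    (L.updateRow r x).det = (∑ v, x v) * (L.updateRow r (Pi.single r 1)).det := by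
  have hzero : (L.updateRow r (x - (∑ v, x v) • Pi.single r 1)).det = 0 := by
    rw [← exists_mulVec_eq_zero_iff]
    refine ⟨1, fun h => one_ne_zero (congrFun h r), ?_⟩
    ext v
    by_cases hv : v = r
    · subst hv
      simp [mulVec, dotProduct, ← Finset.mul_sum]
    · simpa [mulVec, hv] using congrFun hL v
  have := det_updateRow_add L r (x - (∑ v, x v) • Pi.single r 1) ((∑ v, x v) • Pi.single r 1)
  rwa [sub_add_cancel, hzero, zero_add, det_updateRow_smul] at this

-- Adding all rows to row `r` makes it constant, `c * card V`; multiples of the all-ones row then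
-- clear `c` from the other rows. The second factor `card V` is the sum of that all-ones row.
open Matrix in
theorem det_add_const_of_sums_eq_zero {V R : Type*} [Fintype V] [DecidableEq V] [CommRing R]
    [IsDomain R] {L : Matrix V V R} (hrow : L *ᵥ 1 = 0) (hcol : 1 ᵥ* L = 0) (r : V) (c : R) :
    (L + Matrix.of fun _ _ => c).det =
      c * Fintype.card V ^ 2 * (L.updateRow r (Pi.single r 1)).det := by
  have h1 : (L + Matrix.of fun _ _ => c).det =
      ((L + Matrix.of fun _ _ => c).updateRow r ((c * Fintype.card V) • 1)).det := by
    have := det_updateRow_sum (L + Matrix.of fun _ _ => c) r 1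
    rw [Pi.one_apply, one_smul] at this
    rw [← this]
    congr 2
    ext w
    have hw : ∑ v, L v w = 0 := by simpa [vecMul, dotProduct] using congrFun hcol w
    rw [Finset.sum_apply]
    change ∑ v, (1 : R) * (L v w + c) = _
    simp [Finset.sum_add_distrib, hw, mul_comm]
  have h2 : ((L + Matrix.of fun _ _ => c).updateRow r 1).det = (L.updateRow r 1).det := by
    refine det_eq_of_forall_row_eq_smul_add_const (fun v => if v = r then 0 else c) r
      (if_pos rfl) fun v w => ?_
    by_cases hv : v = r
    · subst hv
      simp
    · simp [hv]
  rw [h1, det_updateRow_smul, h2, det_updateRow_of_mulVec_one_eq_zero hrow]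
  simp only [Pi.one_apply, Finset.sum_const, Finset.card_univ, nsmul_eq_mul, mul_one]
  ring

open Matrix in
/-- Temperley's form of the matrix tree theorem. -/
theorem det_lapMatrix_add_const {V R : Type*} [Fintype V] [DecidableEq V] [Nonempty V] [CommRing R]
    [IsDomain R] (G : SimpleGraph V) [DecidableRel G.Adj] (c : R) :
    (G.lapMatrix R + Matrix.of fun _ _ => c).det =
      c * Fintype.card V ^ 2 * numSpanningTrees G := by
  have hrow : G.lapMatrix R *ᵥ 1 = 0 := G.lapMatrix_mulVec_const_eq_zero
  have hcol : 1 ᵥ* G.lapMatrix R = 0 := by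
    rw [← Matrix.mulVec_transpose, (G.isSymm_lapMatrix (R := R)).eq, hrow]
  rw [det_add_const_of_sums_eq_zero hrow hcol (Classical.arbitrary V),
    det_lapMatrix_updateRow_single]

/-! ### The rook's graph -/

open Matrix in
theorem det_scalar_sub_ones {n K : Type*} [Fintype n] [DecidableEq n] [Nonempty n] [Field K]
    {s : K} (hs : s ≠ 0) :
    (s • (1 : Matrix n n K) - Matrix.of fun _ _ => 1).det =
      s ^ (Fintype.card n - 1) * (s - Fintype.card n) := by
  have h : s • (1 : Matrix n n K) - Matrix.of (fun _ _ => 1) =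
      s • (1 + replicateCol Unit (fun _ : n => -s⁻¹) * replicateRow Unit (1 : n → K)) := by
    ext i j
    rw [smul_add, Matrix.sub_apply, Matrix.add_apply, Matrix.smul_apply s (_ * _), Matrix.mul_apply]
    simp [hs, sub_eq_add_neg]
  obtain ⟨m, hm⟩ := Nat.exists_eq_succ_of_ne_zero (Fintype.card_ne_zero (α := n))
  rw [h, det_smul, det_one_add_replicateCol_mul_replicateRow, hm]
  simp only [dotProduct, Pi.one_apply, one_mul, Finset.sum_const, Finset.card_univ, hm,
    nsmul_eq_mul, Nat.succ_sub_one, pow_succ]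
  field_simp
  ring

open Matrix Kronecker in
theorem lapMatrix_rook_add_const {m n K : Type*} [Fintype m] [Fintype n] [DecidableEq m]
    [DecidableEq n] [Field K] (G : SimpleGraph (m × n)) [DecidableRel G.Adj]
    (hG : G = SimpleGraph.completeGraph m □ SimpleGraph.completeGraph n) {s : K} (hs : s ≠ 0)
    (hcard : s = Fintype.card m + Fintype.card n) :
    s • (G.lapMatrix K + Matrix.of fun _ _ => s⁻¹) =
      (s • (1 : Matrix m m K) - Matrix.of fun _ _ => 1) ⊗ₖ
        (s • (1 : Matrix n n K) - Matrix.of fun _ _ => 1) := by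
  have hdeg : ∀ x, (G.degree x : K) = s - 2 := by
    subst hG
    rintro ⟨a, b⟩
    have ha := Nat.cast_pred (R := K) (Fintype.card_pos_iff.2 ⟨a⟩)
    have hb := Nat.cast_pred (R := K) (Fintype.card_pos_iff.2 ⟨b⟩)
    have hd := SimpleGraph.degree_boxProd (G := SimpleGraph.completeGraph m)
      (H := SimpleGraph.completeGraph n) (a, b)
    rw [SimpleGraph.complete_graph_degree, SimpleGraph.complete_graph_degree] at hd
    have hd' : (_ : K) = s - 2 := (congrArg Nat.cast hd).trans <| by
      rw [Nat.cast_add, ha, hb, hcard]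
      ring
    convert hd'
  ext ⟨a, b⟩ ⟨c, d⟩
  simp only [Matrix.smul_apply, Matrix.add_apply, SimpleGraph.lapMatrix, SimpleGraph.degMatrix,
    Matrix.sub_apply, Matrix.diagonal_apply, SimpleGraph.adjMatrix_apply, Matrix.of_apply, hdeg,
    Matrix.kroneckerMap_apply, Matrix.one_apply, smul_eq_mul, hG, SimpleGraph.boxProd_adj,
    SimpleGraph.completeGraph, SimpleGraph.top_adj, Prod.mk.injEq]
  -- Both sides equal (s - 1)², 1 - s or 1, as both, one or none of the coordinates agree.
  by_cases h1 : a = c <;> by_cases h2 : b = d <;> simp [h1, h2, hs, mul_add, mul_sub] <;> ring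

/-- Integer exponents are needed because a side with one vertex gives exponent -1. -/
theorem numSpanningTrees_rook {m n K : Type*} [Fintype m] [Fintype n] [Nonempty m] [Nonempty n]
    [Field K] [CharZero K] :
    (numSpanningTrees (SimpleGraph.completeGraph m □ SimpleGraph.completeGraph n) : K) =
      (Fintype.card m : K) ^ ((Fintype.card m : ℤ) - 2) *
        (Fintype.card n : K) ^ ((Fintype.card n : ℤ) - 2) *
        ((Fintype.card m : K) + Fintype.card n) ^
          (((Fintype.card m : ℤ) - 1) * ((Fintype.card n : ℤ) - 1)) := by
  classical
  have hs : (Fintype.card m : K) + Fintype.card n ≠ 0 := by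
    exact_mod_cast (Nat.add_pos_left Fintype.card_pos _).ne'
  have hm0 : (Fintype.card m : K) ≠ 0 := Nat.cast_ne_zero.2 Fintype.card_ne_zero
  have hn0 : (Fintype.card n : K) ≠ 0 := Nat.cast_ne_zero.2 Fintype.card_ne_zero
  have h := congrArg Matrix.det (lapMatrix_rook_add_const
    (SimpleGraph.completeGraph m □ SimpleGraph.completeGraph n) rfl hs rfl)
  rw [Matrix.det_smul, det_lapMatrix_add_const, Matrix.det_kronecker, det_scalar_sub_ones hs,
    det_scalar_sub_ones hs, add_sub_cancel_left, add_sub_cancel_right, Fintype.card_prod] at h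
  obtain ⟨a, ha⟩ := Nat.exists_eq_succ_of_ne_zero (Fintype.card_ne_zero (α := m))
  obtain ⟨b, hb⟩ := Nat.exists_eq_succ_of_ne_zero (Fintype.card_ne_zero (α := n))
  generalize (numSpanningTrees (SimpleGraph.completeGraph m □ SimpleGraph.completeGraph n) : K)
    = t at h ⊢
  generalize Fintype.card m = M at *
  generalize Fintype.card n = N at *
  have e : (((M : ℤ) - 1) * ((N : ℤ) - 1)) = (a * b : ℕ) := by
    rw [ha, hb]; push_cast; ring
  rw [e, zpow_natCast, zpow_sub₀ hm0, zpow_sub₀ hn0, zpow_natCast, zpow_natCast]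
  set s : K := (M : K) + N with hsdef
  have hpow : s ^ (M * N) * s⁻¹ * s ^ (a * b) = s ^ ((M - 1) * N + (N - 1) * M) := by
    have : (M - 1) * N + (N - 1) * M + 1 = M * N + a * b := by
      rw [ha, hb, Nat.succ_sub_one, Nat.succ_sub_one, Nat.succ_eq_add_one, Nat.succ_eq_add_one]
      ring
    rw [mul_right_comm, ← pow_add, ← this, pow_succ, mul_assoc, mul_inv_cancel₀ hs, mul_one]
  have hne : s ^ (M * N) * s⁻¹ * ((M : K) * N) ^ 2 ≠ 0 := by positivity
  refine mul_left_cancel₀ hne ?_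
  push_cast at h
  calc _ = s ^ (M * N) * (s⁻¹ * ((M : K) * N) ^ 2 * t) := by ring
    _ = _ := h
    _ = s ^ ((M - 1) * N + (N - 1) * M) * ((M : K) ^ M * (N : K) ^ N) := by
      rw [mul_pow, mul_pow, ← pow_mul, ← pow_mul, pow_add]; ring
    _ = _ := by
      rw [← hpow]
      simp only [zpow_ofNat]
      field_simp

theorem mainTheorem3 (n₁ n₂ : ℕ) (h₁ : 1 ≤ n₁) (h₂ : 1 ≤ n₂) :
    (numSpanningTrees
        (SimpleGraph.completeGraph (Fin n₁) □ SimpleGraph.completeGraph (Fin n₂)) : ℚ) =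
      (n₁ : ℚ) ^ ((n₁ : ℤ) - 2) * (n₂ : ℚ) ^ ((n₂ : ℤ) - 2) *
        ((n₁ : ℚ) + (n₂ : ℚ)) ^ (((n₁ : ℤ) - 1) * ((n₂ : ℤ) - 1)) := by
  have : NeZero n₁ := ⟨by omega⟩
  have : NeZero n₂ := ⟨by omega⟩
  simpa using numSpanningTrees_rook (m := Fin n₁) (n := Fin n₂) (K := ℚ)
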